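/- Let $G$ be a finite-dimensional real Lie group with Lie algebra $\mathfrak g$, and let $H$ be a closed subgroup of $G$ with Lie algebra $\mathfrak h=\{X\in\mathfrak g : \exp(tX)\in H \text{ for all } t\in\mathbb R\}$. Endow $M=G/H=\{gH : g\in G\}$ with the quotient topology and the left action of $G$, and put $\vartheta=[e]=eH$. Suppose that $M$ is reductive, with reductive decomposition given by a linear subspace $\mathfrak q\subset\mathfrak g$ such that $$\mathfrak g=\mathfrak h\oplus\mathfrak q,\qquad [\mathfrak h,\mathfrak q]\subset\mathfrak q .$$ Let $R$ be a (not necessarily closed or connected) Lie subgroup of $G$, i.e. the image of a second countable Lie group under an injective immersive smooth homomorphism into $G$, and let $\mathfrak r=T_eR\subset\mathfrak g$ be its Lie algebra. Let $\mathrm{pr}:\mathfrak r\to\mathfrak q$ be the projection parallel to $\mathfrak h$, i.e. $\mathrm{pr}(X)=X_{\mathfrak q}$ where $X=X_{\mathfrak h}+X_{\mathfrak q}$ with $X_{\mathfrak h}\in\mathfrak h$ and $X_{\mathfrak q}\in\mathfrak q$. Then the orbit $R\cdot\vartheta=\{[r] : r\in R\}$ is open in $G/H$ if and only if $\mathrm{pr}:\mathfrak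 r\to\mathfrak q$ is surjective. -/

import Mathlib

open scoped Manifold ContDiff

section LieSubgroups

universe u v

variable {E : Type v} [NormedAddCommGroup E] [NormedSpace ℝ E]
  {G : Type u} [TopologicalSpace G] [ChartedSpace E G] [Group G]

/-- `γ : ℝ → G` is the one-parameter subgroup `t ↦ exp (t X)`: a group homomorphism from `(ℝ, +)`
to `G` with velocity `X` at `t = 0`. (On a Lie group such a `γ` is automatically smooth, and it is
determined by `X`.) -/
def IsOneParameterSubgroup (γ : ℝ → G) (X : GroupLieAlgebra 𝓘(ℝ, E) G) : Prop :=
  (∀ s t : ℝ, γ (s + t) = γ s * γ t) ∧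
    HasMFDerivAt 𝓘(ℝ, ℝ) 𝓘(ℝ, E) γ 0 (ContinuousLinearMap.toSpanSingleton ℝ X)

/-- The Lie algebra of a closed subgroup `H` of a Lie group `G`, namely the set of all `X` in the
Lie algebra of `G` such that `exp (t X) ∈ H` for every real `t`. That set is already a linear
subspace when `H` is closed; the span only makes the definition a `Submodule` by construction. -/
noncomputable def closedSubgroupLieAlgebra (E : Type v) [NormedAddCommGroup E] [NormedSpace ℝ E]
    {G : Type u} [TopologicalSpace G] [ChartedSpace E G] [Group G] (H : Subgroup G) :
    Submodule ℝ (GroupLieAlgebra 𝓘(ℝ, E) G) :=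
  Submodule.span ℝ {X | ∃ γ : ℝ → G, IsOneParameterSubgroup γ X ∧ ∀ t : ℝ, γ t ∈ H}

/-- `R` is a (not necessarily closed or connected) Lie subgroup of `G` with Lie algebra `𝔯`: `R` is
the image of a second countable Lie group `L` under an injective homomorphism `ι : L → G` that is a
smooth immersion, and `𝔯` is the tangent space of `R` at the identity, i.e. the image of the
tangent space of `L` at the identity under the differential of `ι`. -/
def IsLieSubgroupWithLieAlgebra (R : Subgroup G)
    (𝔯 : Submodule ℝ (GroupLieAlgebra 𝓘(ℝ, E) G)) : Prop :=
  ∃ (d : ℕ) (L : Type u) (_ : Group L) (_ : TopologicalSpace L)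
    (_ : ChartedSpace (EuclideanSpace ℝ (Fin d)) L) (ι : L →* G),
    LieGroup 𝓘(ℝ, EuclideanSpace ℝ (Fin d)) ∞ L ∧
    SecondCountableTopology L ∧
    Function.Injective ι ∧
    Manifold.IsImmersion 𝓘(ℝ, EuclideanSpace ℝ (Fin d)) 𝓘(ℝ, E) ∞ ι ∧
    ι.range = R ∧
    ∀ X : GroupLieAlgebra 𝓘(ℝ, E) G, X ∈ 𝔯 ↔
      ∃ v : GroupLieAlgebra 𝓘(ℝ, EuclideanSpace ℝ (Fin d)) L,
        mfderiv 𝓘(ℝ, EuclideanSpace ℝ (Fin d)) 𝓘(ℝ, E) ι 1 v = X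

/-- `𝔤 = 𝔥 ⊕ 𝔮` with `[𝔥, 𝔮] ⊆ 𝔮`, where `𝔤` is the Lie algebra of `G`. -/
structure IsReductiveDecomposition (𝔥 𝔮 : Submodule ℝ (GroupLieAlgebra 𝓘(ℝ, E) G)) : Prop where
  isCompl : IsCompl 𝔮 𝔥
  lie_mem : ∀ X ∈ 𝔥, ∀ Y ∈ 𝔮, ⁅X, Y⁆ ∈ 𝔮

end LieSubgroups

/-! The preimage of the orbit in `G` is `R * H`, and the projection onto `𝔮` has kernel `𝔥`, so the
claim is that `R * H` is open iff `𝔯 + 𝔥 = 𝔤` (`isOpen_range_mul_iff`, with `R` the image of `ι : L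
→ G`). The argument takes place in charts at `1` and needs no manifold structure on `G ⧸ H`.

If `𝔯 + 𝔥 = 𝔤`, multiply `ι` by finitely many one-parameter subgroups of `H` whose velocities span
`𝔥`. The resulting map has surjective strict derivative, hence is open at `1`
(`image_mul_subgroup_mem_nhds_one`).

Conversely, let `R * H` be open. By Baire, `ι '' V * H` is a neighbourhood of `1` for every
neighbourhood `V` of `1` in `L` (`image_mul_mem_nhds_one_of_isOpen_range_mul`). Directions of `L`
sent into `𝔥` generate one-parameter subgroups of `H.comap ι`, which `H` absorbs, so `L` may be
replaced by a slice `S` on which the differential is injective modulo `𝔥`. Points near `1` on a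
curve of velocity `X` then factor as a small slice element times an element of `H`; rescaling and
passing to the limit puts `X` in `𝔯 + 𝔥` (`range_sup_closedSubgroupLieAlgebra_eq_top`). The limit of
the `H`-factors lies in `𝔥` because `H` is closed (`IsOneParameterSubgroup.mem_of_hasDirection`). -/

section OpenOrbits

open Filter Topology Set
open scoped Pointwise

/-! ### First-order calculus at the identity. -/

section ChartAtOne

variable {E : Type*} [NormedAddCommGroup E] [NormedSpace ℝ E]
  {F : Type*} [NormedAddCommGroup F] [NormedSpace ℝ F]
  {F' : Type*} [NormedAddCommGroup F'] [NormedSpace ℝ F']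
  {G : Type*} [TopologicalSpace G] [ChartedSpace E G] [Group G]

/-- `f x₀ = 1` and, read in the preferred chart at `1`, `f` is strictly differentiable at `x₀`. -/
structure HasStrictDerivAtOne (f : F → G) (f' : F →L[ℝ] E) (x₀ : F) : Prop where
  map_eq_one : f x₀ = 1
  continuousAt : ContinuousAt f x₀
  hasStrictFDerivAt : HasStrictFDerivAt (fun x ↦ extChartAt 𝓘(ℝ, E) (1 : G) (f x)) f' x₀

/-- Along `l`, `a` tends to `1` and, read in the preferred chart at `1`, is `δ • X + o(δ)`. -/
structure HasDirection {α : Type*} (l : Filter α) (δ : α → ℝ) (a : α → G) (X : E) : Prop where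
  tendsto_one : Tendsto a l (𝓝 1)
  tendsto_smul : Tendsto (fun i ↦ (δ i)⁻¹ •
    (extChartAt 𝓘(ℝ, E) (1 : G) (a i) - extChartAt 𝓘(ℝ, E) (1 : G) 1)) l (𝓝 X)

lemma HasStrictDerivAtOne.comp {f : F → G} {f' : F →L[ℝ] E} {g : F' → F} {g' : F' →L[ℝ] F}
    {x₀ : F'} (hf : HasStrictDerivAtOne f f' (g x₀)) (hg : HasStrictFDerivAt g g' x₀) :
    HasStrictDerivAtOne (f ∘ g) (f'.comp g') x₀ :=
  ⟨hf.1, ContinuousAt.comp hf.2 hg.continuousAt, hf.3.comp x₀ hg⟩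

lemma HasStrictDerivAtOne.congr {f g : F → G} {f' : F →L[ℝ] E} {x₀ : F}
    (hf : HasStrictDerivAtOne f f' x₀) (h : f =ᶠ[𝓝 x₀] g) : HasStrictDerivAtOne g f' x₀ :=
  ⟨h.eq_of_nhds ▸ hf.1, hf.2.congr h,
    hf.3.congr_of_eventuallyEq (h.mono fun x hx ↦ by simp only [hx])⟩

lemma HasStrictDerivAtOne.hasDirection {f : F → G} {f' : F →L[ℝ] E} {x₀ : F}
    (hf : HasStrictDerivAtOne f f' x₀) {α : Type*} {l : Filter α} {δ : α → ℝ}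
    {x : α → F} (hx : Tendsto x l (𝓝 x₀)) {v : F}
    (hv : Tendsto (fun i ↦ (δ i)⁻¹ • (x i - x₀)) l (𝓝 v)) :
    HasDirection l δ (fun i ↦ f (x i)) (f' v) := by
  refine ⟨?_, ?_⟩
  · have := hf.2.tendsto.comp hx
    rwa [hf.1] at this
  · have := (hf.3.hasFDerivAt.hasFDerivWithinAt (s := univ)).lim (l := l)
      (c := fun i ↦ (δ i)⁻¹) (d := fun i ↦ x i - x₀) (v := v)
      (by simpa using hx.sub_const x₀) (by simp) hv
    simpa [hf.1] using this

lemma HasStrictDerivAtOne.map_nhds [FiniteDimensional ℝ E] [CompleteSpace F]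
    {f : F → G} {f' : F →L[ℝ] E} {x₀ : F}
    (hf : HasStrictDerivAtOne f f' x₀) (h : f'.range = ⊤) : map f (𝓝 x₀) = 𝓝 1 := by
  have := FiniteDimensional.complete ℝ E
  have h1 := hf.3.map_nhds_eq_of_surj h
  rw [hf.1] at h1
  have h2 : map (extChartAt 𝓘(ℝ, E) (1 : G)).symm
      (map (fun x ↦ extChartAt 𝓘(ℝ, E) (1 : G) (f x)) (𝓝 x₀)) = map f (𝓝 x₀) := by
    rw [map_map]
    apply Filter.map_congr
    have : ∀ᶠ x in 𝓝 x₀, f x ∈ (extChartAt 𝓘(ℝ, E) (1 : G)).source :=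
      hf.2.eventually_mem (by rw [hf.1]; exact extChartAt_source_mem_nhds _)
    filter_upwards [this] with x hx
    exact (extChartAt 𝓘(ℝ, E) (1 : G)).left_inv hx
  rw [← h2, h1]
  have := map_extChartAt_symm_nhdsWithin_range (I := 𝓘(ℝ, E)) (1 : G)
  simpa using this

lemma hasStrictDerivAtOne_extChartAt_symm :
    HasStrictDerivAtOne (extChartAt 𝓘(ℝ, E) (1 : G)).symm (ContinuousLinearMap.id ℝ E)
      (extChartAt 𝓘(ℝ, E) (1 : G) 1) := by
  refine ⟨by simp, continuousAt_extChartAt_symm _, ?_⟩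
  refine (hasStrictFDerivAt_id _).congr_of_eventuallyEq ?_
  filter_upwards [extChartAt_target_mem_nhds (I := 𝓘(ℝ, E)) (1 : G)] with x hx
  exact ((extChartAt 𝓘(ℝ, E) (1 : G)).right_inv hx).symm

lemma HasStrictDerivAtOne.of_contMDiffAt {f : F → G} {x₀ : F}
    [IsManifold 𝓘(ℝ, E) 1 G] (h1 : f x₀ = 1) (hf : ContMDiffAt 𝓘(ℝ, F) 𝓘(ℝ, E) 1 f x₀) :
    HasStrictDerivAtOne f (fderiv ℝ (fun x ↦ extChartAt 𝓘(ℝ, E) (1 : G) (f x)) x₀) x₀ := by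
  refine ⟨h1, hf.continuousAt, ?_⟩
  have h2 : ContMDiffAt 𝓘(ℝ, F) 𝓘(ℝ, E) 1 (fun x ↦ extChartAt 𝓘(ℝ, E) (1 : G) (f x)) x₀ := by
    refine ContMDiffAt.comp x₀ (I' := 𝓘(ℝ, E)) ?_ hf
    rw [h1]
    exact contMDiffAt_extChartAt
  exact h2.contDiffAt.hasStrictFDerivAt one_ne_zero

/-- Fixing one factor at `1` turns the product into the inverse chart, whose derivative is the
identity; this determines both partial derivatives. -/
lemma hasStrictDerivAtOne_mul [LieGroup 𝓘(ℝ, E) 1 G] :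
    HasStrictDerivAtOne (fun p : E × E ↦ (extChartAt 𝓘(ℝ, E) (1 : G)).symm p.1 *
        (extChartAt 𝓘(ℝ, E) (1 : G)).symm p.2)
      (ContinuousLinearMap.fst ℝ E E + ContinuousLinearMap.snd ℝ E E)
      (extChartAt 𝓘(ℝ, E) (1 : G) 1, extChartAt 𝓘(ℝ, E) (1 : G) 1) := by
  have : IsManifold 𝓘(ℝ, E) 1 G := LieGroup.toContMDiffMul.toIsManifold
  set e := extChartAt 𝓘(ℝ, E) (1 : G) 1 with he
  have hs : ContMDiffAt 𝓘(ℝ, E) 𝓘(ℝ, E) 1 (extChartAt 𝓘(ℝ, E) (1 : G)).symm e :=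
    (contMDiffOn_extChartAt_symm (1 : G)).contMDiffAt (extChartAt_target_mem_nhds _)
  have h1 : ContMDiffAt 𝓘(ℝ, E × E) 𝓘(ℝ, E) 1
      (fun p : E × E ↦ (extChartAt 𝓘(ℝ, E) (1 : G)).symm p.1) (e, e) :=
    ContMDiffAt.comp (I' := 𝓘(ℝ, E)) (e, e) hs contDiff_fst.contMDiff.contMDiffAt
  have h2 : ContMDiffAt 𝓘(ℝ, E × E) 𝓘(ℝ, E) 1
      (fun p : E × E ↦ (extChartAt 𝓘(ℝ, E) (1 : G)).symm p.2) (e, e) :=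
    ContMDiffAt.comp (I' := 𝓘(ℝ, E)) (e, e) hs contDiff_snd.contMDiff.contMDiffAt
  have h3 := HasStrictDerivAtOne.of_contMDiffAt (G := G) (by simp [e]) (h1.mul h2)
  have h4 := (hasStrictDerivAtOne_extChartAt_symm (E := E) (G := G)).3
  have k1 := h3.3.comp (f := fun x ↦ (x, e)) e
    ((hasStrictFDerivAt_id e).prodMk (hasStrictFDerivAt_const e e))
  have k2 := h3.3.comp (f := fun x ↦ (e, x)) e
    ((hasStrictFDerivAt_const e e).prodMk (hasStrictFDerivAt_id e))
  simp only [Pi.mul_apply] at k1 k2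
  have s1 : (extChartAt 𝓘(ℝ, E) (1 : G)).symm e = 1 := by simp [e]
  simp only [s1, mul_one, one_mul] at k1 k2
  have u1 := k1.hasFDerivAt.unique h4.hasFDerivAt
  have u2 := k2.hasFDerivAt.unique h4.hasFDerivAt
  convert! h3 using 1
  ext1
  · exact u1.symm ▸ by ext; simp
  · exact u2.symm ▸ by ext; simp

lemma eventually_symm_mul_symm {α : Type*} {l : Filter α} {a b : α → G}
    (ha : Tendsto a l (𝓝 1)) (hb : Tendsto b l (𝓝 1)) :
    ∀ᶠ i in l, (extChartAt 𝓘(ℝ, E) (1 : G)).symm (extChartAt 𝓘(ℝ, E) (1 : G) (a i)) *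
      (extChartAt 𝓘(ℝ, E) (1 : G)).symm (extChartAt 𝓘(ℝ, E) (1 : G) (b i)) = a i * b i := by
  filter_upwards [ha.eventually_mem (extChartAt_source_mem_nhds (I := 𝓘(ℝ, E)) (1 : G)),
    hb.eventually_mem (extChartAt_source_mem_nhds (I := 𝓘(ℝ, E)) (1 : G))] with i hi hj
  rw [PartialEquiv.left_inv _ hi, PartialEquiv.left_inv _ hj]

lemma HasStrictDerivAtOne.mul [LieGroup 𝓘(ℝ, E) 1 G] {f g : F → G} {f' g' : F →L[ℝ] E} {x₀ : F}
    (hf : HasStrictDerivAtOne f f' x₀) (hg : HasStrictDerivAtOne g g' x₀) :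
    HasStrictDerivAtOne (fun x ↦ f x * g x) (f' + g') x₀ := by
  have hm := hasStrictDerivAtOne_mul (E := E) (G := G)
  have hp := hf.3.prodMk hg.3
  have := HasStrictDerivAtOne.comp (g := fun x ↦ (extChartAt 𝓘(ℝ, E) (1 : G) (f x),
    extChartAt 𝓘(ℝ, E) (1 : G) (g x))) (x₀ := x₀) (by simpa only [hf.1, hg.1] using hm) hp
  convert! this.congr ?_ using 1
  exact eventually_symm_mul_symm (by simpa only [hf.1] using hf.2.tendsto)
    (by simpa only [hg.1] using hg.2.tendsto)

lemma HasDirection.mul [LieGroup 𝓘(ℝ, E) 1 G] {α : Type*} {l : Filter α} {δ : α → ℝ}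
    {a b : α → G} {X Y : E}
    (ha : HasDirection l δ a X) (hb : HasDirection l δ b Y) :
    HasDirection l δ (fun i ↦ a i * b i) (X + Y) := by
  have hm := hasStrictDerivAtOne_mul (E := E) (G := G)
  have hc := (continuousAt_extChartAt (I := 𝓘(ℝ, E)) (1 : G)).tendsto
  have := hm.hasDirection ((hc.comp ha.1).prodMk_nhds (hc.comp hb.1)) (v := (X, Y))
    (by simpa using ha.2.prodMk_nhds hb.2)
  have hev := eventually_symm_mul_symm (E := E) ha.1 hb.1
  refine ⟨this.1.congr' hev, ?_⟩
  have h2 := this.2.congr' (f₂ := fun i ↦ (δ i)⁻¹ •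
    (extChartAt 𝓘(ℝ, E) (1 : G) (a i * b i) - extChartAt 𝓘(ℝ, E) (1 : G) 1))
    (hev.mono fun i hi ↦ by simp only [Function.comp_apply, hi])
  simpa using h2

lemma HasDirection.congr {α : Type*} {l : Filter α} {δ : α → ℝ} {a b : α → G} {X : E}
    (ha : HasDirection l δ a X) (h : a =ᶠ[l] b) : HasDirection l δ b X :=
  ⟨ha.1.congr' h, ha.2.congr' (h.mono fun i hi ↦ by simp only [hi])⟩

lemma HasDirection.unique {α : Type*} {l : Filter α} [l.NeBot] {δ : α → ℝ} {a : α → G} {X Y : E}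
    (hX : HasDirection l δ a X) (hY : HasDirection l δ a Y) : X = Y :=
  tendsto_nhds_unique hX.2 hY.2

end ChartAtOne

/-! ### One-parameter subgroups and norm estimates near the identity. -/

section OneParameterSubgroups

variable {E : Type*} [NormedAddCommGroup E] [NormedSpace ℝ E]
  {F : Type*} [NormedAddCommGroup F] [NormedSpace ℝ F]
  {G : Type*} [TopologicalSpace G] [ChartedSpace E G] [Group G]

lemma HasMFDerivAt.hasFDerivAt_extChartAt_one {f : F → G} {x₀ : F} (h1 : f x₀ = 1)
    {f' : F →L[ℝ] E} (hf : HasMFDerivAt 𝓘(ℝ, F) 𝓘(ℝ, E) f x₀ f') :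
    HasFDerivAt (fun x ↦ extChartAt 𝓘(ℝ, E) (1 : G) (f x)) f' x₀ := by
  have := hf.2
  simp only [writtenInExtChartAt, h1, mfld_simps] at this
  have h2 : HasFDerivWithinAt (fun x ↦ extChartAt 𝓘(ℝ, E) (1 : G) (f x)) f' univ x₀ := this
  exact hasFDerivWithinAt_univ.1 h2

namespace IsOneParameterSubgroup

variable {γ : ℝ → G} {X : GroupLieAlgebra 𝓘(ℝ, E) G}

lemma map_zero (h : IsOneParameterSubgroup γ X) : γ 0 = 1 := by
  have := h.1 0 0
  simpa using this

lemma map_neg (h : IsOneParameterSubgroup γ X) (t : ℝ) : γ (-t) = (γ t)⁻¹ := by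
  rw [eq_inv_iff_mul_eq_one, ← h.1, neg_add_cancel, h.map_zero]

lemma map_nat_mul (h : IsOneParameterSubgroup γ X) (n : ℕ) (t : ℝ) : γ (n * t) = γ t ^ n := by
  induction n with
  | zero => simp [h.map_zero]
  | succ n ih => rw [pow_succ, ← ih, ← h.1]; push_cast; ring_nf

lemma continuous [IsTopologicalGroup G] (h : IsOneParameterSubgroup γ X) : Continuous γ := by
  rw [continuous_iff_continuousAt]
  intro t
  have h0 := h.2.continuousAt
  have : γ = fun s ↦ γ t * γ (s - t) := by
    ext s
    rw [← h.1]; ring_nf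
  rw [this]
  refine continuousAt_const.mul (ContinuousAt.comp (f := fun s ↦ s - t) ?_ (by fun_prop))
  simpa using h0

lemma smul (h : IsOneParameterSubgroup γ X) (c : ℝ) :
    IsOneParameterSubgroup (fun t ↦ γ (c * t)) (c • X) := by
  refine ⟨fun s t ↦ by simp only [mul_add, h.1], ?_⟩
  have h2 : HasMFDerivAt 𝓘(ℝ, ℝ) 𝓘(ℝ, ℝ) (fun t : ℝ ↦ c * t) 0
      (c • ContinuousLinearMap.id ℝ ℝ) :=
    ((hasFDerivAt_id (0 : ℝ)).const_mul c).hasMFDerivAt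
  have h1 : HasMFDerivAt 𝓘(ℝ, ℝ) 𝓘(ℝ, E) γ (c * 0) (ContinuousLinearMap.toSpanSingleton ℝ X) := by
    rw [mul_zero]; exact h.2
  have h3 : ContinuousLinearMap.toSpanSingleton ℝ (c • X) =
      (ContinuousLinearMap.toSpanSingleton ℝ X).comp (c • ContinuousLinearMap.id ℝ ℝ) := by
    refine ContinuousLinearMap.ext fun t ↦ ?_
    change t • (c • X) = (c • t) • X
    rw [smul_smul, smul_eq_mul, mul_comm]
  exact (HasMFDerivAt.comp (0 : ℝ) h1 h2).congr_mfderiv h3.symm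

/-- The group law upgrades the derivative at `0` to a strict one: `γ s = γ t * γ (s - t)`, so strict
differentiability of the product reduces the increment from `t` to `s` to the one from `0` to `s -
t`. -/
lemma hasStrictDerivAtOne [LieGroup 𝓘(ℝ, E) 1 G] {X : E} (h : IsOneParameterSubgroup γ X) :
    HasStrictDerivAtOne γ (ContinuousLinearMap.toSpanSingleton ℝ X) 0 := by
  have : IsTopologicalGroup G := topologicalGroup_of_lieGroup 𝓘(ℝ, E) 1
  refine ⟨h.map_zero, h.2.continuousAt, ?_⟩
  have hm := (hasStrictDerivAtOne_mul (E := E) (G := G)).3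
  set e := extChartAt 𝓘(ℝ, E) (1 : G) 1 with he
  set g : ℝ → E := fun x ↦ extChartAt 𝓘(ℝ, E) (1 : G) (γ x) with hg
  have h0 : HasFDerivAt g (ContinuousLinearMap.toSpanSingleton ℝ X) 0 :=
    h.2.hasFDerivAt_extChartAt_one h.map_zero
  have hg0 : g 0 = e := by simp [g, h.map_zero, e]
  have hgc : Tendsto g (𝓝 0) (𝓝 e) := hg0 ▸ h0.continuousAt.tendsto
  have hsub : Tendsto (fun p : ℝ × ℝ ↦ p.1 - p.2) (𝓝 (0, 0)) (𝓝 0) := by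
    have : Continuous (fun p : ℝ × ℝ ↦ p.1 - p.2) := by fun_prop
    simpa using this.tendsto (0, 0)
  have hsnd : Tendsto (fun p : ℝ × ℝ ↦ p.2) (𝓝 (0, 0)) (𝓝 0) := by
    simpa using (continuous_snd (X := ℝ) (Y := ℝ)).tendsto (0, 0)
  have hdiff : (fun p : ℝ × ℝ ↦ g (p.1 - p.2) - e) =O[𝓝 (0, 0)] fun p ↦ p.1 - p.2 := by
    have := h0.isBigO_sub.comp_tendsto hsub
    simpa [Function.comp_def, hg0] using this
  have hlit : (fun p : ℝ × ℝ ↦ g (p.1 - p.2) - e - (p.1 - p.2) • X) =o[𝓝 (0, 0)]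
      fun p ↦ p.1 - p.2 := by
    have := h0.isLittleO.comp_tendsto hsub
    simpa [Function.comp_def, hg0] using this
  -- For `p = (s, t)` the two pairs compared have products `γ t * γ (s - t) = γ s` and `γ t * 1 = γ
  -- t`.
  have hT : Tendsto (fun p : ℝ × ℝ ↦ ((g p.2, g (p.1 - p.2)), (g p.2, e))) (𝓝 (0, 0))
      (𝓝 ((e, e), (e, e))) :=
    ((hgc.comp hsnd).prodMk_nhds (hgc.comp hsub)).prodMk_nhds
      ((hgc.comp hsnd).prodMk_nhds tendsto_const_nhds)
  have hmo := hm.isLittleO.comp_tendsto hT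
  have hmo2 : (fun p : ℝ × ℝ ↦ g p.1 - g p.2 - (g (p.1 - p.2) - e)) =o[𝓝 (0, 0)]
      fun p ↦ p.1 - p.2 := by
    refine (hmo.trans_isBigO ?_).congr' ?_ EventuallyEq.rfl
    · refine Asymptotics.IsBigO.trans ?_ hdiff
      refine Asymptotics.IsBigO.of_bound 1 (Eventually.of_forall fun p ↦ ?_)
      simp
    · have h1 : Tendsto γ (𝓝 0) (𝓝 1) := h.map_zero ▸ h.2.continuousAt.tendsto
      filter_upwards [eventually_symm_mul_symm (E := E) (h1.comp hsnd) (h1.comp hsub),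
        eventually_symm_mul_symm (E := E) (h1.comp hsnd) (tendsto_const_nhds (x := (1 : G)))]
        with p hp hp'
      simp only [Function.comp_apply] at hp hp'
      simp only [Function.comp_apply, g, e, hp, hp', mul_one, ← h.1]
      simp
  refine .of_isLittleO ?_
  refine (hmo2.add hlit).congr_left fun p ↦ ?_
  simp only [ContinuousLinearMap.toSpanSingleton_apply]
  abel

lemma hasDirection [LieGroup 𝓘(ℝ, E) 1 G] {X : E} (h : IsOneParameterSubgroup γ X)
    {α : Type*} {l : Filter α} {δ : α → ℝ} (hδ : Tendsto δ l (𝓝[>] 0)) (c : ℝ) :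
    HasDirection l δ (fun i ↦ γ (c * δ i)) (c • X) := by
  have h0 := tendsto_nhds_of_tendsto_nhdsWithin hδ
  refine h.hasStrictDerivAtOne.hasDirection (v := c) (by simpa using h0.const_mul c) ?_
  refine tendsto_const_nhds.congr' ?_
  filter_upwards [hδ.eventually self_mem_nhdsWithin] with i (hi : 0 < δ i)
  rw [sub_zero, smul_eq_mul]; field_simp

lemma hasDirection_self [LieGroup 𝓘(ℝ, E) 1 G] {X : E} (h : IsOneParameterSubgroup γ X)
    {α : Type*} {l : Filter α} {δ : α → ℝ} (hδ : Tendsto δ l (𝓝[>] 0)) :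
    HasDirection l δ (fun i ↦ γ (δ i)) X := by
  simpa using h.hasDirection hδ 1

end IsOneParameterSubgroup

variable (E) in
/-- A neighbourhood of `1` contains the points of the chart at `1` whose coordinates are close to
those of `1`. -/
lemma exists_norm_extChartAt_sub_lt {N : Set G} (hN : N ∈ 𝓝 (1 : G)) :
    ∃ r > 0, ∀ g ∈ (extChartAt 𝓘(ℝ, E) (1 : G)).source,
      ‖extChartAt 𝓘(ℝ, E) (1 : G) g - extChartAt 𝓘(ℝ, E) (1 : G) 1‖ < r → g ∈ N := by
  have h := (continuousAt_extChartAt_symm (I := 𝓘(ℝ, E)) (1 : G)).tendsto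
  rw [extChartAt_to_inv] at h
  obtain ⟨r, hr, hrN⟩ := Metric.mem_nhds_iff.1 (h hN)
  refine ⟨r, hr, fun g hg hgr ↦ ?_⟩
  have := @hrN (extChartAt 𝓘(ℝ, E) (1 : G) g) (by rwa [Metric.mem_ball, dist_eq_norm])
  rwa [mem_preimage, (extChartAt 𝓘(ℝ, E) (1 : G)).left_inv hg] at this

/-- Compare `p.1 * p.2` with `p.1 * 1` by the Lipschitz bound. The coefficient `1` on the first term
keeps errors additive in long products. -/
lemma exists_norm_extChartAt_mul_le [LieGroup 𝓘(ℝ, E) 1 G] :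
    ∃ C ≥ 0, ∀ᶠ p : G × G in 𝓝 (1, 1),
      ‖extChartAt 𝓘(ℝ, E) (1 : G) (p.1 * p.2) - extChartAt 𝓘(ℝ, E) (1 : G) 1‖ ≤
        ‖extChartAt 𝓘(ℝ, E) (1 : G) p.1 - extChartAt 𝓘(ℝ, E) (1 : G) 1‖ +
        C * ‖extChartAt 𝓘(ℝ, E) (1 : G) p.2 - extChartAt 𝓘(ℝ, E) (1 : G) 1‖ := by
  obtain ⟨K, s, hs, hK⟩ :=
    (hasStrictDerivAtOne_mul (E := E) (G := G)).3.exists_lipschitzOnWith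
  refine ⟨K, K.2, ?_⟩
  have hc := (continuousAt_extChartAt (I := 𝓘(ℝ, E)) (1 : G)).tendsto
  have h1 : Tendsto (fun p : G × G ↦ p.1) (𝓝 (1, 1)) (𝓝 1) := continuous_fst.tendsto (1, 1)
  have h2 : Tendsto (fun p : G × G ↦ p.2) (𝓝 (1, 1)) (𝓝 1) := continuous_snd.tendsto (1, 1)
  have h3 : Tendsto (fun p : G × G ↦ (1 : G)) (𝓝 (1, 1)) (𝓝 1) := tendsto_const_nhds
  filter_upwards [eventually_symm_mul_symm (E := E) h1 h2, eventually_symm_mul_symm (E := E) h1 h3,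
    ((hc.comp h1).prodMk_nhds (hc.comp h2)).eventually_mem hs,
    ((hc.comp h1).prodMk_nhds (hc.comp h3)).eventually_mem hs] with p e1 e2 m1 m2
  have := hK.norm_sub_le m1 m2
  simp only [Function.comp_apply, e1, e2, mul_one, Prod.mk_sub_mk, sub_self, Prod.norm_mk,
    norm_zero, norm_nonneg, sup_of_le_right] at this
  calc _ = ‖(extChartAt 𝓘(ℝ, E) (1 : G) p.1 - extChartAt 𝓘(ℝ, E) (1 : G) 1) +
        (extChartAt 𝓘(ℝ, E) (1 : G) (p.1 * p.2) - extChartAt 𝓘(ℝ, E) (1 : G) p.1)‖ := by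
          congr 1; abel
    _ ≤ _ := (norm_add_le _ _).trans (by gcongr)

/-- Conjugation is Lipschitz in charts and fixes `1`, so compare with the conjugate of `1` by the
same element. -/
lemma exists_norm_extChartAt_conj_le [LieGroup 𝓘(ℝ, E) 1 G] :
    ∃ C ≥ 0, ∀ᶠ p : G × G in 𝓝 (1, 1),
      ‖extChartAt 𝓘(ℝ, E) (1 : G) (p.1 * p.2 * p.1⁻¹) - extChartAt 𝓘(ℝ, E) (1 : G) 1‖ ≤
        C * ‖extChartAt 𝓘(ℝ, E) (1 : G) p.2 - extChartAt 𝓘(ℝ, E) (1 : G) 1‖ := by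
  have : IsManifold 𝓘(ℝ, E) 1 G := LieGroup.toContMDiffMul.toIsManifold
  set e := extChartAt 𝓘(ℝ, E) (1 : G) 1 with he
  have hs : ContMDiffAt 𝓘(ℝ, E) 𝓘(ℝ, E) 1 (extChartAt 𝓘(ℝ, E) (1 : G)).symm e :=
    (contMDiffOn_extChartAt_symm (1 : G)).contMDiffAt (extChartAt_target_mem_nhds _)
  have h1 : ContMDiffAt 𝓘(ℝ, E × E) 𝓘(ℝ, E) 1
      (fun p : E × E ↦ (extChartAt 𝓘(ℝ, E) (1 : G)).symm p.1) (e, e) :=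
    ContMDiffAt.comp (I' := 𝓘(ℝ, E)) (e, e) hs contDiff_fst.contMDiff.contMDiffAt
  have h2 : ContMDiffAt 𝓘(ℝ, E × E) 𝓘(ℝ, E) 1
      (fun p : E × E ↦ (extChartAt 𝓘(ℝ, E) (1 : G)).symm p.2) (e, e) :=
    ContMDiffAt.comp (I' := 𝓘(ℝ, E)) (e, e) hs contDiff_snd.contMDiff.contMDiffAt
  have h3 := HasStrictDerivAtOne.of_contMDiffAt (G := G) (by simp [e]) ((h1.mul h2).mul h1.inv)
  obtain ⟨K, s, hs, hK⟩ := h3.3.exists_lipschitzOnWith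
  refine ⟨K, K.2, ?_⟩
  have hc := (continuousAt_extChartAt (I := 𝓘(ℝ, E)) (1 : G)).tendsto
  have h1 : Tendsto (fun p : G × G ↦ p.1) (𝓝 (1, 1)) (𝓝 1) := continuous_fst.tendsto (1, 1)
  have h2 : Tendsto (fun p : G × G ↦ p.2) (𝓝 (1, 1)) (𝓝 1) := continuous_snd.tendsto (1, 1)
  have h3 : Tendsto (fun p : G × G ↦ (1 : G)) (𝓝 (1, 1)) (𝓝 1) := tendsto_const_nhds
  filter_upwards [h1.eventually_mem (extChartAt_source_mem_nhds (I := 𝓘(ℝ, E)) (1 : G)),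
    h2.eventually_mem (extChartAt_source_mem_nhds (I := 𝓘(ℝ, E)) (1 : G)),
    ((hc.comp h1).prodMk_nhds (hc.comp h2)).eventually_mem hs,
    ((hc.comp h1).prodMk_nhds (hc.comp h3)).eventually_mem hs] with p s1 s2 m1 m2
  have := hK.norm_sub_le m1 m2
  simp only [Function.comp_apply, Pi.mul_apply, PartialEquiv.left_inv _ s1,
    PartialEquiv.left_inv _ s2, extChartAt_to_inv, mul_one, mul_inv_cancel, Prod.mk_sub_mk,
    sub_self, Prod.norm_mk, norm_zero, norm_nonneg, sup_of_le_right] at this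
  exact this

end OneParameterSubgroups

/-! ### Neighbourhoods filled by a subgroup, and limit directions of closed subgroups. -/

section ClosedSubgroups

universe w

variable {E : Type*} [NormedAddCommGroup E] [NormedSpace ℝ E]
  {G : Type*} [TopologicalSpace G] [ChartedSpace E G] [Group G]

/-- Each generator `X` adds a factor `ℝ` to the source and replaces `f` by `f * γ`; the new factor
lies in `H` and is absorbed. The source `F` therefore varies in the induction. -/
lemma image_mul_subgroup_mem_nhds_one_of_finset [FiniteDimensional ℝ E] [LieGroup 𝓘(ℝ, E) 1 G]
    (H : Subgroup G) (s : Finset E)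
    (hs : ∀ X ∈ s, ∃ γ : ℝ → G, IsOneParameterSubgroup γ X ∧ ∀ t, γ t ∈ H) :
    ∀ {F : Type w} [NormedAddCommGroup F] [NormedSpace ℝ F] [CompleteSpace F] {f : F → G}
      {f' : F →L[ℝ] E} {x₀ : F}, HasStrictDerivAtOne f f' x₀ →
      f'.range ⊔ Submodule.span ℝ (s : Set E) = ⊤ →
      ∀ N ∈ 𝓝 x₀, f '' N * (H : Set G) ∈ 𝓝 1 := by
  classical
  induction s using Finset.induction_on with
  | empty =>
    intro F _ _ _ f f' x₀ hf htop N hN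
    simp only [Finset.coe_empty, Submodule.span_empty, bot_le, sup_of_le_left] at htop
    rw [← hf.map_nhds htop]
    refine mem_of_superset (image_mem_map hN) fun g hg ↦ ⟨g, hg, 1, H.one_mem, mul_one g⟩
  | insert X s _ ih =>
    intro F _ _ _ f f' x₀ hf htop N hN
    obtain ⟨γ, hγ, hγH⟩ := hs X (Finset.mem_insert_self X s)
    have h1 : HasStrictDerivAtOne (fun p : F × ℝ ↦ f p.1) (f'.comp (.fst ℝ F ℝ)) (x₀, (0 : ℝ)) :=
      HasStrictDerivAtOne.comp (g := Prod.fst) (x₀ := (x₀, (0 : ℝ))) hf hasStrictFDerivAt_fst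
    have h2 : HasStrictDerivAtOne (fun p : F × ℝ ↦ γ p.2)
        ((ContinuousLinearMap.toSpanSingleton ℝ X).comp (.snd ℝ F ℝ)) (x₀, (0 : ℝ)) :=
      HasStrictDerivAtOne.comp (g := Prod.snd) (x₀ := (x₀, (0 : ℝ))) hγ.hasStrictDerivAtOne
        hasStrictFDerivAt_snd
    have h3 := ih (fun Y hY ↦ hs Y (Finset.mem_insert_of_mem hY)) (h1.mul h2) ?_
      (N ×ˢ univ) (prod_mem_nhds hN univ_mem)
    · refine mem_of_superset h3 ?_
      rintro _ ⟨_, ⟨p, hp, rfl⟩, h, hh, rfl⟩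
      exact ⟨f p.1, ⟨p.1, hp.1, rfl⟩, γ p.2 * h, H.mul_mem (hγH _) hh, (mul_assoc _ _ _).symm⟩
    · rw [eq_top_iff, ← htop, Finset.coe_insert, Submodule.span_insert, ← sup_assoc]
      refine sup_le_sup_right (sup_le ?_ ?_) _
      · rintro _ ⟨v, rfl⟩
        exact ⟨(v, 0), by simp⟩
      · rw [Submodule.span_singleton_le_iff_mem]
        exact ⟨(0, 1), by simp⟩

lemma image_mul_subgroup_mem_nhds_one [FiniteDimensional ℝ E] [LieGroup 𝓘(ℝ, E) 1 G]
    (H : Subgroup G) {F : Type*} [NormedAddCommGroup F] [NormedSpace ℝ F] [CompleteSpace F]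
    {f : F → G} {f' : F →L[ℝ] E} {x₀ : F} (hf : HasStrictDerivAtOne f f' x₀)
    (htop : f'.range ⊔ (closedSubgroupLieAlgebra E H : Submodule ℝ E) = ⊤)
    {N : Set F} (hN : N ∈ 𝓝 x₀) : f '' N * (H : Set G) ∈ 𝓝 1 := by
  obtain ⟨t, ht, hspan⟩ := (Submodule.fg_span_iff_fg_span_finset_subset
    {X : E | ∃ γ : ℝ → G, IsOneParameterSubgroup γ X ∧ ∀ t : ℝ, γ t ∈ H}).1
    (IsNoetherian.noetherian (R := ℝ) (M := E) _)
  refine image_mul_subgroup_mem_nhds_one_of_finset H t (fun X hX ↦ ht hX) hf ?_ N hN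
  rw [← hspan]
  exact htop

/-- A product of `k` conjugates, by elements near `1`, of an element `b` with `k • b` small. -/
lemma exists_norm_extChartAt_prod_conj_le [LieGroup 𝓘(ℝ, E) 1 G] :
    ∃ V ∈ 𝓝 (1 : G), ∃ C ≥ 0, ∃ r > 0, ∀ (u g : ℕ → G) (b : G) (k : ℕ), u 0 = 1 →
      (∀ j, u (j + 1) = u j * (g j * b * (g j)⁻¹)) → b ∈ V → (∀ j < k, g j ∈ V) →
      k * (C * ‖extChartAt 𝓘(ℝ, E) (1 : G) b - extChartAt 𝓘(ℝ, E) (1 : G) 1‖) < r →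
      u k ∈ (extChartAt 𝓘(ℝ, E) (1 : G)).source ∧
      ‖extChartAt 𝓘(ℝ, E) (1 : G) (u k) - extChartAt 𝓘(ℝ, E) (1 : G) 1‖ ≤
        k * (C * ‖extChartAt 𝓘(ℝ, E) (1 : G) b - extChartAt 𝓘(ℝ, E) (1 : G) 1‖) := by
  have : IsTopologicalGroup G := topologicalGroup_of_lieGroup 𝓘(ℝ, E) 1
  obtain ⟨C₁, hC₁, h₁⟩ := exists_norm_extChartAt_mul_le (E := E) (G := G)
  obtain ⟨C₂, hC₂, h₂⟩ := exists_norm_extChartAt_conj_le (E := E) (G := G)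
  have hmul : Tendsto (fun p : G × G ↦ p.1 * p.2) (𝓝 (1, 1)) (𝓝 1) := by
    simpa using (continuous_mul (M := G)).tendsto (1, 1)
  have hconj : Tendsto (fun p : G × G ↦ p.1 * p.2 * p.1⁻¹) (𝓝 (1, 1)) (𝓝 1) := by
    have : Continuous (fun p : G × G ↦ p.1 * p.2 * p.1⁻¹) := by fun_prop
    simpa using this.tendsto (1, 1)
  have h₁' := h₁.and (hmul.eventually_mem (extChartAt_source_mem_nhds (I := 𝓘(ℝ, E)) (1 : G)))
  rw [nhds_prod_eq] at h₁'
  obtain ⟨U, hU, h₁'⟩ := mem_prod_self_iff.1 h₁'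
  have h₂' := h₂.and (hconj.eventually_mem hU)
  rw [nhds_prod_eq] at h₂'
  obtain ⟨V, hV, h₂'⟩ := mem_prod_self_iff.1 h₂'
  obtain ⟨r, hr, hrU⟩ := exists_norm_extChartAt_sub_lt E hU
  refine ⟨V, hV, C₁ * C₂, by positivity, r, hr, fun u g b k hu0 hu hb hg hk ↦ ?_⟩
  set ν : G → ℝ := fun x ↦ ‖extChartAt 𝓘(ℝ, E) (1 : G) x - extChartAt 𝓘(ℝ, E) (1 : G) 1‖ with hν
  have hνb : 0 ≤ C₁ * C₂ * ν b := mul_nonneg (by positivity) (norm_nonneg _)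
  suffices ∀ j ≤ k, u j ∈ (extChartAt 𝓘(ℝ, E) (1 : G)).source ∧
      ν (u j) ≤ j * (C₁ * C₂ * ν b) from this k le_rfl
  intro j
  induction j with
  | zero => exact fun _ ↦ ⟨by rw [hu0]; exact mem_extChartAt_source _, by simp [hu0, ν]⟩
  | succ j ih =>
    intro hj
    obtain ⟨ih1, ih2⟩ := ih (by omega)
    have hjk : (j : ℝ) ≤ k := by exact_mod_cast (by omega : j ≤ k)
    have huU : u j ∈ U := hrU _ ih1 (ih2.trans_lt ((by gcongr : _ ≤ _).trans_lt hk))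
    obtain ⟨c1, c2⟩ := h₂' (mk_mem_prod (hg j (by omega)) hb)
    obtain ⟨d1, d2⟩ := h₁' (mk_mem_prod huU c2)
    refine ⟨by rw [hu]; exact d2, ?_⟩
    rw [hu]
    refine d1.trans ?_
    calc _ ≤ j * (C₁ * C₂ * ν b) + C₁ * (C₂ * ν b) :=
          add_le_add ih2 (mul_le_mul_of_nonneg_left c1 hC₁)
      _ = _ := by push_cast; ring

/-- If elements of a closed subgroup approach `1` in the direction `X`, then the one-parameter
subgroup with velocity `X` lies in that subgroup. -/
lemma IsOneParameterSubgroup.mem_of_hasDirection [LieGroup 𝓘(ℝ, E) 1 G] {H : Subgroup G}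
    (hH : IsClosed (H : Set G)) {γ : ℝ → G} {X : E} (hγ : IsOneParameterSubgroup γ X)
    {α : Type*} {l : Filter α} [l.NeBot] {δ : α → ℝ} (hδ : Tendsto δ l (𝓝[>] 0)) {a : α → G}
    (ha : ∀ᶠ i in l, a i ∈ H) (hX : HasDirection l δ a X) (t : ℝ) : γ t ∈ H := by
  have : IsTopologicalGroup G := topologicalGroup_of_lieGroup 𝓘(ℝ, E) 1
  obtain ⟨V, hV, C, hC, r, hr, hVr⟩ := exists_norm_extChartAt_prod_conj_le (E := E) (G := G)
  obtain ⟨hδ0, hδpos⟩ := tendsto_nhdsWithin_iff.1 hδ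
  -- The discrepancy between `a i` and `γ (δ i)` is `o(δ i)`, so about `t / δ i` conjugates of it
  -- still multiply to something tending to `1`.
  have hb : HasDirection l δ (fun i ↦ a i * γ (-1 * δ i)) (0 : E) := by
    simpa using hX.mul (hγ.hasDirection hδ (-1))
  obtain ⟨T, hT, hTV⟩ : ∃ T > 0, ∀ s, |s| ≤ T → γ s ∈ V := by
    have h0 : γ ⁻¹' V ∈ 𝓝 0 := by
      apply hγ.continuous.continuousAt.preimage_mem_nhds
      rwa [hγ.map_zero]
    obtain ⟨T, hT, h⟩ := Metric.mem_nhds_iff.1 h0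
    refine ⟨T / 2, by positivity, fun s hs ↦ h ?_⟩
    rw [Metric.mem_ball, Real.dist_eq, sub_zero]; linarith
  have key : ∀ t, 0 ≤ t → t ≤ T → γ t ∈ H := by
    intro t ht0 htT
    let k : α → ℕ := fun i ↦ ⌊t / δ i⌋₊
    have hk : Tendsto (fun i ↦ (k i : ℝ) * δ i) l (𝓝 t) := by
      refine tendsto_of_tendsto_of_tendsto_of_le_of_le' (g := fun i ↦ t - δ i) (h := fun _ ↦ t)
        (by simpa using hδ0.const_sub t) tendsto_const_nhds ?_ ?_
      · filter_upwards [hδpos] with i (hi : 0 < δ i)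
        have := (Nat.lt_floor_add_one (t / δ i)).le
        rw [div_le_iff₀ hi] at this
        simp only [k]; linarith
      · filter_upwards [hδpos] with i (hi : 0 < δ i)
        have := Nat.floor_le (div_nonneg ht0 hi.le)
        rwa [le_div_iff₀ hi] at this
    have hsmall : Tendsto (fun i ↦ (k i : ℝ) * (C * ‖extChartAt 𝓘(ℝ, E) (1 : G)
        (a i * γ (-1 * δ i)) - extChartAt 𝓘(ℝ, E) (1 : G) 1‖)) l (𝓝 0) := by
      have := (hk.mul (hb.2.norm)).const_mul C
      rw [norm_zero, mul_zero, mul_zero] at this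
      refine this.congr' ?_
      filter_upwards [hδpos] with i (hi : 0 < δ i)
      rw [norm_smul, norm_inv, Real.norm_of_nonneg hi.le]
      field_simp
    have hu : ∀ᶠ i in l, a i ^ k i * γ (-(k i * δ i)) ∈ (extChartAt 𝓘(ℝ, E) (1 : G)).source ∧
        ‖extChartAt 𝓘(ℝ, E) (1 : G) (a i ^ k i * γ (-(k i * δ i))) -
          extChartAt 𝓘(ℝ, E) (1 : G) 1‖ ≤ (k i : ℝ) * (C * ‖extChartAt 𝓘(ℝ, E) (1 : G)
        (a i * γ (-1 * δ i)) - extChartAt 𝓘(ℝ, E) (1 : G) 1‖) := by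
      filter_upwards [hδpos, hsmall.eventually_lt_const hr, hb.1.eventually_mem hV]
        with i (hi : 0 < δ i) hi2 hi3
      refine hVr (fun j ↦ a i ^ j * γ (-(j * δ i))) (fun j ↦ γ (j * δ i)) _ (k i)
        (by simp [hγ.map_zero]) (fun j ↦ ?_) hi3 (fun j hj ↦ hTV _ ?_) hi2
      -- With `b = a * γ (-δ)`, conjugating by `γ (j * δ)` gives `a ^ (j + 1) * γ (-(j + 1) * δ) = a
      -- ^ j * γ (-j * δ) * (γ (j * δ) * b * γ (j * δ)⁻¹)`.
      · have e1 : -(((j + 1 : ℕ) : ℝ) * δ i) = -1 * δ i + -(j * δ i) := by push_cast; ring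
        rw [e1, hγ.1, hγ.map_neg (j * δ i), pow_succ]
        group
      · rw [abs_of_nonneg (by positivity)]
        refine le_trans ?_ htT
        have h1 := Nat.floor_le (div_nonneg ht0 hi.le)
        rw [le_div_iff₀ hi] at h1
        refine le_trans ?_ h1
        have : (j : ℝ) ≤ k i := by exact_mod_cast hj.le
        gcongr
    have hu1 : Tendsto (fun i ↦ a i ^ k i * γ (-(k i * δ i))) l (𝓝 1) := by
      intro N hN
      obtain ⟨ρ, hρ, hN'⟩ := exists_norm_extChartAt_sub_lt E hN
      have hρ' := hsmall.eventually_lt_const hρ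
      change ∀ᶠ i in l, _ ∈ N
      filter_upwards [hu, hρ'] with i h1 h2
      exact hN' _ h1.1 (h1.2.trans_lt h2)
    have hlim : Tendsto (fun i ↦ a i ^ k i) l (𝓝 (γ t)) := by
      have := hu1.mul ((hγ.continuous.tendsto t).comp hk)
      rw [one_mul] at this
      refine this.congr fun i ↦ ?_
      simp [hγ.map_neg]
    exact hH.mem_of_tendsto hlim (ha.mono fun i hi ↦ H.pow_mem hi _)
  have key2 : ∀ t, 0 ≤ t → γ t ∈ H := by
    intro t ht
    obtain ⟨n, hn⟩ := exists_nat_gt (t / T)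
    have hn0 : (0 : ℝ) < n := lt_of_le_of_lt (by positivity) hn
    have h1 : γ t = γ (t / n) ^ n := by rw [← hγ.map_nat_mul]; congr 1; field_simp
    rw [h1]
    refine H.pow_mem (key _ (by positivity) ?_) _
    rw [div_le_iff₀ hn0]
    rw [div_lt_iff₀ hT] at hn
    linarith
  rcases le_total 0 t with ht | ht
  · exact key2 t ht
  · have := key2 (-t) (by linarith)
    rw [hγ.map_neg] at this
    exact inv_mem_iff.1 this

end ClosedSubgroups

/-! ### Existence of one-parameter subgroups and linearity of `𝔥`. -/

section Exponential

variable {E : Type*} [NormedAddCommGroup E] [NormedSpace ℝ E]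
  {G : Type*} [TopologicalSpace G] [ChartedSpace E G] [Group G]

lemma mfderiv_mul_left_mulInvariantVectorField [LieGroup 𝓘(ℝ, E) 1 G]
    (X : GroupLieAlgebra 𝓘(ℝ, E) G) (g h : G) :
    mfderiv 𝓘(ℝ, E) 𝓘(ℝ, E) (g * ·) h (mulInvariantVectorField X h) =
      mulInvariantVectorField X (g * h) := by
  have h1 : HasMFDerivAt 𝓘(ℝ, E) 𝓘(ℝ, E) (g * ·) (h * 1)
      (mfderiv 𝓘(ℝ, E) 𝓘(ℝ, E) (g * ·) h : E →L[ℝ] E) := by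
    rw [mul_one]
    exact ((contMDiff_mul_left (n := 1)).contMDiffAt.mdifferentiableAt one_ne_zero).hasMFDerivAt
  have h2 : HasMFDerivAt 𝓘(ℝ, E) 𝓘(ℝ, E) (h * ·) (1 : G)
      (mfderiv 𝓘(ℝ, E) 𝓘(ℝ, E) (h * ·) (1 : G)) :=
    ((contMDiff_mul_left (n := 1)).contMDiffAt.mdifferentiableAt one_ne_zero).hasMFDerivAt
  have h3 := (HasMFDerivAt.comp (1 : G) h1 h2).mfderiv
  have h4 : ((g * ·) ∘ (h * ·) : G → G) = (g * h * ·) := by ext x; simp [mul_assoc]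
  rw [h4] at h3
  exact (congrArg (fun A ↦ A X) h3).symm

lemma mulInvariantVectorField_one (X : GroupLieAlgebra 𝓘(ℝ, E) G) :
    mulInvariantVectorField X (1 : G) = X := by
  have h1 : HasMFDerivAt 𝓘(ℝ, E) 𝓘(ℝ, E) ((1 : G) * ·) 1 (ContinuousLinearMap.id ℝ E) :=
    (hasMFDerivAt_id (1 : G)).congr_of_eventuallyEq (Eventually.of_forall fun x ↦ one_mul x)
  exact congrArg (fun A ↦ A X) h1.mfderiv

lemma IsMIntegralCurveOn.mul_left [LieGroup 𝓘(ℝ, E) 1 G]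
    {X : GroupLieAlgebra 𝓘(ℝ, E) G} {γ : ℝ → G} {s : Set ℝ}
    (hγ : IsMIntegralCurveOn (I := 𝓘(ℝ, E)) γ (mulInvariantVectorField X) s) (g : G) :
    IsMIntegralCurveOn (I := 𝓘(ℝ, E)) (fun t ↦ g * γ t) (mulInvariantVectorField X) s := by
  intro t ht
  have h1 : MDifferentiableAt 𝓘(ℝ, E) 𝓘(ℝ, E) (g * ·) (γ t) :=
    (contMDiff_mul_left (n := 1)).contMDiffAt.mdifferentiableAt one_ne_zero
  have h2 := HasMFDerivAt.comp_hasMFDerivWithinAt t h1.hasMFDerivAt (hγ t ht)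
  refine h2.congr_mfderiv ?_
  refine ContinuousLinearMap.ext fun (c : ℝ) ↦ ?_
  have h3 := mfderiv_mul_left_mulInvariantVectorField X g (γ t)
  change mfderiv 𝓘(ℝ, E) 𝓘(ℝ, E) (g * ·) (γ t) (c • mulInvariantVectorField X (γ t)) =
    c • mulInvariantVectorField X (g * γ t)
  rw [map_smul, h3]

/-- Every element of the Lie algebra is the velocity of a one-parameter subgroup. -/
lemma exists_isOneParameterSubgroup [CompleteSpace E] [T2Space G] [LieGroup 𝓘(ℝ, E) ∞ G]
    (X : GroupLieAlgebra 𝓘(ℝ, E) G) : ∃ γ : ℝ → G, IsOneParameterSubgroup γ X := by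
  have : LieGroup 𝓘(ℝ, E) 1 G := .of_le (n := ∞) (by simp)
  have : LieGroup 𝓘(ℝ, E) (minSmoothness ℝ 3) G :=
    .of_le (n := ∞) (by simp only [minSmoothness_of_isRCLikeNormedField]; exact ENat.LEInfty.out)
  have : IsManifold 𝓘(ℝ, E) 1 G := LieGroup.toContMDiffMul.toIsManifold
  have hv : ContMDiff 𝓘(ℝ, E) 𝓘(ℝ, E).tangent 1
      (fun g : G ↦ (mulInvariantVectorField X g : TangentBundle 𝓘(ℝ, E) G)) :=
    (contMDiff_mulInvariantVectorField X).of_le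
      (by simp only [minSmoothness_of_isRCLikeNormedField]; norm_num)
  obtain ⟨c, hc0, hc⟩ := exists_isMIntegralCurveAt_of_contMDiffAt_boundaryless 0
    (hv.contMDiffAt (x := (1 : G)))
  obtain ⟨ε, hε, hc⟩ := isMIntegralCurveAt_iff'.1 hc
  rw [Real.ball_eq_Ioo, zero_sub, zero_add] at hc
  -- Left translates of one local integral curve exist for the same time `ε` at every point, which
  -- makes the field complete.
  obtain ⟨γ, hγ0, hγ⟩ := exists_isMIntegralCurve_of_isMIntegralCurveOn hv hε
    (fun g ↦ ⟨fun t ↦ g * c t, by simp [hc0], IsMIntegralCurveOn.mul_left hc g⟩) 1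
  refine ⟨γ, fun s t ↦ ?_, ?_⟩
  · have h1 := hγ.comp_add s
    have h2 : IsMIntegralCurve (I := 𝓘(ℝ, E)) (fun t ↦ γ s * γ t) (mulInvariantVectorField X) := by
      rw [isMIntegralCurve_iff_isMIntegralCurveOn] at hγ ⊢
      exact IsMIntegralCurveOn.mul_left hγ _
    have h3 := isMIntegralCurve_Ioo_eq_of_contMDiff_boundaryless (t₀ := 0) hv h1 h2
      (by simp [hγ0])
    have h4 := congrFun h3 t
    simpa [add_comm] using h4
  · refine (hγ 0).congr_mfderiv ?_
    refine ContinuousLinearMap.ext fun (r : ℝ) ↦ ?_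
    change r • mulInvariantVectorField X (γ 0) = r • X
    congr 1
    rw [hγ0]
    exact mulInvariantVectorField_one X

/-- The velocities of the one-parameter subgroups of a closed subgroup form a linear subspace. -/
lemma mem_closedSubgroupLieAlgebra_iff [CompleteSpace E] [T2Space G] [LieGroup 𝓘(ℝ, E) ∞ G]
    {H : Subgroup G} (hH : IsClosed (H : Set G)) {X : GroupLieAlgebra 𝓘(ℝ, E) G} :
    X ∈ closedSubgroupLieAlgebra E H ↔
      ∃ γ : ℝ → G, IsOneParameterSubgroup γ X ∧ ∀ t : ℝ, γ t ∈ H := by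
  have : LieGroup 𝓘(ℝ, E) 1 G := .of_le (n := ∞) (by simp)
  refine ⟨fun hX ↦ ?_, fun hX ↦ Submodule.subset_span hX⟩
  induction hX using Submodule.span_induction with
  | mem X hX => exact hX
  | zero =>
    refine ⟨fun _ ↦ 1, ⟨by simp, ?_⟩, fun _ ↦ H.one_mem⟩
    refine (hasMFDerivAt_const (1 : G) (0 : ℝ)).congr_mfderiv ?_
    refine ContinuousLinearMap.ext fun (r : ℝ) ↦ ?_
    change (0 : E) = r • (0 : E)
    simp
  | add X Y _ _ hX hY =>
    obtain ⟨γ, hγ, hγH⟩ := hX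
    obtain ⟨η, hη, hηH⟩ := hY
    obtain ⟨ξ, hξ⟩ := exists_isOneParameterSubgroup (X + Y)
    have hid : Tendsto (fun t : ℝ ↦ t) (𝓝[>] 0) (𝓝[>] 0) := tendsto_id
    -- The curve `γ t * η t` stays in `H` and has direction `X + Y`.
    have := (hγ.hasDirection_self hid).mul (hη.hasDirection_self hid)
    exact ⟨ξ, hξ, hξ.mem_of_hasDirection hH hid
      (Eventually.of_forall fun t ↦ H.mul_mem (hγH _) (hηH _)) this⟩
  | smul c X _ hX =>
    obtain ⟨γ, hγ, hγH⟩ := hX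
    exact ⟨_, hγ.smul c, fun t ↦ hγH _⟩

lemma mem_closedSubgroupLieAlgebra_of_hasDirection [CompleteSpace E] [T2Space G]
    [LieGroup 𝓘(ℝ, E) ∞ G] {H : Subgroup G} (hH : IsClosed (H : Set G)) {X : E}
    {α : Type*} {l : Filter α} [l.NeBot] {δ : α → ℝ} (hδ : Tendsto δ l (𝓝[>] 0)) {a : α → G}
    (ha : ∀ᶠ i in l, a i ∈ H) (hX : HasDirection l δ a X) :
    X ∈ closedSubgroupLieAlgebra E H := by
  have : LieGroup 𝓘(ℝ, E) 1 G := .of_le (n := ∞) (by simp)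
  obtain ⟨γ, hγ⟩ := exists_isOneParameterSubgroup (G := G) (X : GroupLieAlgebra 𝓘(ℝ, E) G)
  exact (mem_closedSubgroupLieAlgebra_iff hH).2 ⟨γ, hγ, hγ.mem_of_hasDirection hH hδ ha hX⟩

end Exponential

/-! ### The Baire category argument. -/

section Baire

/-- If the image of a second countable locally compact group, multiplied by a closed subgroup, is
open, then so are the products with the images of neighbourhoods of `1`, near `1`. -/
lemma image_mul_mem_nhds_one_of_isOpen_range_mul {L G : Type*}
    [Group L] [TopologicalSpace L] [IsTopologicalGroup L] [SecondCountableTopology L]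
    [LocallyCompactSpace L] [Group G] [TopologicalSpace G] [IsTopologicalGroup G] [BaireSpace G]
    {H : Subgroup G} (hH : IsClosed (H : Set G)) (ι : L →* G) (hι : Continuous ι)
    (hopen : IsOpen (range ι * (H : Set G))) {V : Set L} (hV : V ∈ 𝓝 1) :
    ι '' V * (H : Set G) ∈ 𝓝 1 := by
  obtain ⟨W, hW, hWV⟩ : ∃ W ∈ 𝓝 (1 : L), ∀ v ∈ W, ∀ w ∈ W, v⁻¹ * w ∈ V := by
    have : Tendsto (fun p : L × L ↦ p.1⁻¹ * p.2) (𝓝 (1, 1)) (𝓝 1) := by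
      have : Continuous (fun p : L × L ↦ p.1⁻¹ * p.2) := by fun_prop
      simpa using this.tendsto (1, 1)
    have h := this hV
    rw [nhds_prod_eq] at h
    obtain ⟨W, hW, h⟩ := mem_prod_self_iff.1 h
    exact ⟨W, hW, fun v hv w hw ↦ h (mk_mem_prod hv hw)⟩
  obtain ⟨K, hK, hKW, hKc⟩ := local_compact_nhds hW
  obtain ⟨s, hs, hsU⟩ := TopologicalSpace.countable_cover_nhds (f := fun l : L ↦ l • K)
    (fun l ↦ by simpa using smul_mem_nhds_smul l hK)
  have hcl : ∀ l : L, IsClosed (ι '' (l • K) * (H : Set G)) := fun l ↦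
    hH.mul_left_of_isCompact ((hKc.smul l).image hι)
  set O := range ι * (H : Set G) with hO
  -- Adding the closed set `Oᶜ` to the countable family makes it cover `G`, so Baire applies to `G`
  -- itself; a point chosen in `O` then rules out `Oᶜ`.
  have hdense := dense_sUnion_interior_of_closed
    (S := insert Oᶜ ((fun l : L ↦ ι '' (l • K) * (H : Set G)) '' s))
    (by rintro _ (rfl | ⟨l, _, rfl⟩); exacts [hopen.isClosed_compl, hcl l])
    ((hs.image _).insert _) (by
      rw [eq_univ_iff_forall]
      intro g
      by_cases hg : g ∈ O
      · obtain ⟨_, ⟨l, rfl⟩, h, hh, rfl⟩ := hg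
        obtain ⟨m, hm, hlm⟩ : ∃ m ∈ s, l ∈ m • K :=
          mem_iUnion₂.1 (hsU ▸ mem_univ l : l ∈ ⋃ x ∈ s, x • K) |>.imp fun m hm ↦ by simpa using hm
        exact ⟨_, Or.inr ⟨m, hm, rfl⟩, mul_mem_mul (mem_image_of_mem ι hlm) hh⟩
      · exact ⟨_, Or.inl rfl, hg⟩)
  obtain ⟨g, hgO, hg⟩ := hdense.inter_open_nonempty O hopen
    ⟨1, 1, ⟨1, map_one ι⟩, 1, H.one_mem, by simp⟩
  simp only [mem_iUnion] at hg
  obtain ⟨A, hA, hgA⟩ := hg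
  rcases hA with rfl | ⟨l, _, rfl⟩
  · exact absurd hgO (interior_subset hgA)
  obtain ⟨_, ⟨_, ⟨k, hk, rfl⟩, rfl⟩, h, hh, hkh⟩ := interior_subset hgA
  have hnh : ι '' (l • K) * (H : Set G) ∈ 𝓝 g := mem_interior_iff_mem_nhds.1 hgA
  -- Two-sided translation carries the interior point `g = ι (l • k) * h` back to `1`, leaving the
  -- factor `k⁻¹ * k'`, which lies in `V`.
  have htend : Tendsto (fun x : G ↦ ι (l • k) * x * h) (𝓝 1) (𝓝 g) := by
    have : Continuous (fun x : G ↦ ι (l • k) * x * h) := by fun_prop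
    have h1 := this.tendsto 1
    simp only [mul_one] at h1
    rwa [show ι (l • k) * h = g from hkh] at h1
  filter_upwards [htend hnh] with x hx
  obtain ⟨_, ⟨_, ⟨k', hk', rfl⟩, rfl⟩, h', hh', hx⟩ := hx
  refine ⟨_, ⟨k⁻¹ * k', hWV _ (hKW hk) _ (hKW hk'), rfl⟩, h' * h⁻¹,
    H.mul_mem hh' (H.inv_mem hh), ?_⟩
  simp only [smul_eq_mul, map_mul] at hx
  simp only [map_mul, map_inv]
  have hx2 : ι k' * h' = ι k * x * h := by
    apply mul_left_cancel (a := ι l)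
    simpa [mul_assoc] using hx
  rw [mul_assoc, ← mul_assoc (ι k'), hx2]
  group

end Baire

/-! ### Differentials of homomorphisms and the rescaling argument. -/

section Homomorphisms

variable {E : Type*} [NormedAddCommGroup E] [NormedSpace ℝ E]
  {G : Type*} [TopologicalSpace G] [ChartedSpace E G] [Group G]
  {E' : Type*} [NormedAddCommGroup E'] [NormedSpace ℝ E']
  {L : Type*} [TopologicalSpace L] [ChartedSpace E' L] [Group L]

lemma MonoidHom.hasStrictDerivAtOne_comp_extChartAt_symm [IsManifold 𝓘(ℝ, E') 1 L]
    [IsManifold 𝓘(ℝ, E) 1 G] (ι : L →* G) (hι : ContMDiff 𝓘(ℝ, E') 𝓘(ℝ, E) 1 ι) :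
    HasStrictDerivAtOne (E := E) (G := G) (ι ∘ (extChartAt 𝓘(ℝ, E') (1 : L)).symm)
      (mfderiv 𝓘(ℝ, E') 𝓘(ℝ, E) ι 1 : E' →L[ℝ] E) (extChartAt 𝓘(ℝ, E') (1 : L) 1) := by
  have hs : ContMDiffAt 𝓘(ℝ, E') 𝓘(ℝ, E') 1 (extChartAt 𝓘(ℝ, E') (1 : L)).symm
      (extChartAt 𝓘(ℝ, E') (1 : L) 1) :=
    (contMDiffOn_extChartAt_symm (1 : L)).contMDiffAt (extChartAt_target_mem_nhds _)
  have h1 := HasStrictDerivAtOne.of_contMDiffAt (G := G) (by simp)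
    (ContMDiffAt.comp _ hι.contMDiffAt hs)
  have h2 := (hι.contMDiffAt (x := (1 : L))).mdifferentiableAt one_ne_zero |>.hasMFDerivAt.2
  simp only [writtenInExtChartAt, map_one, mfld_simps] at h2
  have h3 : HasFDerivAt (fun x ↦ extChartAt 𝓘(ℝ, E) (1 : G)
      (ι ((extChartAt 𝓘(ℝ, E') (1 : L)).symm x)))
      (mfderiv 𝓘(ℝ, E') 𝓘(ℝ, E) ι 1 : E' →L[ℝ] E) (extChartAt 𝓘(ℝ, E') (1 : L) 1) :=
    hasFDerivWithinAt_univ.1 h2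
  have h4 := h1.3.hasFDerivAt.unique h3
  rwa [h4] at h1

lemma IsOneParameterSubgroup.map {γ : ℝ → L} {v : GroupLieAlgebra 𝓘(ℝ, E') L}
    (hγ : IsOneParameterSubgroup γ v) (ι : L →* G) (hι : ContMDiff 𝓘(ℝ, E') 𝓘(ℝ, E) 1 ι) :
    IsOneParameterSubgroup (ι ∘ γ) (mfderiv 𝓘(ℝ, E') 𝓘(ℝ, E) ι 1 v : E) := by
  refine ⟨fun s t ↦ by simp [hγ.1], ?_⟩
  have h1 : HasMFDerivAt 𝓘(ℝ, E') 𝓘(ℝ, E) ι (γ 0)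
      (mfderiv 𝓘(ℝ, E') 𝓘(ℝ, E) ι 1 : E' →L[ℝ] E) := by
    rw [hγ.map_zero]
    exact (hι.contMDiffAt.mdifferentiableAt one_ne_zero).hasMFDerivAt
  refine (HasMFDerivAt.comp (0 : ℝ) h1 hγ.2).congr_mfderiv ?_
  refine ContinuousLinearMap.ext fun (r : ℝ) ↦ ?_
  exact map_smul (mfderiv 𝓘(ℝ, E') 𝓘(ℝ, E) ι 1 : E' →L[ℝ] E) r v

/-- The image under `ι` of the one-parameter subgroup of `v` has the same velocity as some `η`
inside `H`; using `η` as the approximating family forces that image into `H`. -/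
lemma mem_closedSubgroupLieAlgebra_comap [CompleteSpace E] [CompleteSpace E'] [T2Space G]
    [T2Space L] [LieGroup 𝓘(ℝ, E) ∞ G] [LieGroup 𝓘(ℝ, E') ∞ L] {H : Subgroup G}
    (hH : IsClosed (H : Set G)) (ι : L →* G) (hι : ContMDiff 𝓘(ℝ, E') 𝓘(ℝ, E) 1 ι)
    {v : GroupLieAlgebra 𝓘(ℝ, E') L}
    (hv : (mfderiv 𝓘(ℝ, E') 𝓘(ℝ, E) ι 1 v : E) ∈ closedSubgroupLieAlgebra E H) :
    v ∈ closedSubgroupLieAlgebra E' (H.comap ι) := by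
  have : LieGroup 𝓘(ℝ, E) 1 G := .of_le (n := ∞) (by simp)
  obtain ⟨γ, hγ⟩ := exists_isOneParameterSubgroup v
  obtain ⟨η, hη, hηH⟩ := (mem_closedSubgroupLieAlgebra_iff hH).1 hv
  have hid : Tendsto (fun t : ℝ ↦ t) (𝓝[>] 0) (𝓝[>] 0) := tendsto_id
  refine Submodule.subset_span ⟨γ, hγ, fun t ↦ ?_⟩
  refine (hγ.map ι hι).mem_of_hasDirection hH hid (a := η)
    (Eventually.of_forall hηH) (hη.hasDirection_self hid) t

lemma Ultrafilter.exists_tendsto_inv_smul {α V : Type*} [NormedAddCommGroup V] [NormedSpace ℝ V]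
    [ProperSpace V] (u : Ultrafilter α) {δ : α → ℝ} {z : α → V}
    (hδ : ∀ᶠ i in (u : Filter α), 0 < δ i) (hz : ∀ᶠ i in (u : Filter α), ‖z i‖ ≤ δ i) :
    ∃ w, Tendsto (fun i ↦ (δ i)⁻¹ • z i) u (𝓝 w) := by
  obtain ⟨w, _, hw⟩ := (isCompact_closedBall (0 : V) 1).ultrafilter_le_nhds
    (u.map fun i ↦ (δ i)⁻¹ • z i) (by
      rw [Ultrafilter.coe_map, le_principal_iff, Filter.mem_map]
      filter_upwards [hδ, hz] with i hi hzi
      rw [mem_preimage, mem_closedBall_zero_iff, norm_smul, norm_inv, Real.norm_of_nonneg hi.le,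
        inv_mul_le_iff₀ hi, mul_one]
      exact hzi)
  exact ⟨w, hw⟩

/-- If a parametrized surface through `1`, transverse to a closed subgroup `H`, is such that its
translates by `H` fill neighbourhoods of `1`, then it is complementary to `H` at `1`. -/
lemma range_sup_closedSubgroupLieAlgebra_eq_top [FiniteDimensional ℝ E] [FiniteDimensional ℝ E']
    [T2Space G] [LieGroup 𝓘(ℝ, E) ∞ G] {H : Subgroup G} (hH : IsClosed (H : Set G))
    {f : E' → G} {f' : E' →L[ℝ] E} (hf : HasStrictDerivAtOne f f' 0)
    (hf' : ∀ v, f' v ∈ (closedSubgroupLieAlgebra E H : Submodule ℝ E) → v = 0)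
    (hN : ∀ N ∈ 𝓝 (0 : E'), f '' N * (H : Set G) ∈ 𝓝 1) :
    f'.range ⊔ (closedSubgroupLieAlgebra E H : Submodule ℝ E) = ⊤ := by
  have : LieGroup 𝓘(ℝ, E) 1 G := .of_le (n := ∞) (by simp)
  have : IsTopologicalGroup G := topologicalGroup_of_lieGroup 𝓘(ℝ, E) 1
  have := FiniteDimensional.complete ℝ E
  have := FiniteDimensional.proper ℝ E
  have := FiniteDimensional.proper ℝ E'
  refine eq_top_iff.2 fun X _ ↦ ?_
  set e := extChartAt 𝓘(ℝ, E) (1 : G) 1 with he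
  let g : ℝ → G := (extChartAt 𝓘(ℝ, E) (1 : G)).symm ∘ fun t : ℝ ↦ e + t • X
  have hg : HasStrictDerivAtOne g ((ContinuousLinearMap.id ℝ E).comp
      (ContinuousLinearMap.toSpanSingleton ℝ X)) 0 := by
    refine HasStrictDerivAtOne.comp (by rw [zero_smul, add_zero]; exact hasStrictDerivAtOne_extChartAt_symm) ?_
    exact (ContinuousLinearMap.toSpanSingleton ℝ X).hasStrictFDerivAt.const_add e
  let h : ℝ × E' → G := fun p ↦ (f p.2)⁻¹ * g p.1
  -- Pairs `(t, s)` with `t ↓ 0`, `s → 0` and `g t ∈ f s * H`; the filter is nontrivial by `hN`.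
  let l : Filter (ℝ × E') := (𝓝[>] (0 : ℝ) ×ˢ 𝓝 (0 : E')) ⊓ 𝓟 {p | h p ∈ H}
  have hl : l.NeBot := by
    refine inf_principal_neBot_iff.2 fun U hU ↦ ?_
    obtain ⟨T, hT, N, hN', hTN⟩ := mem_prod_iff.1 hU
    have h1 : g ⁻¹' (f '' N * (H : Set G)) ∈ 𝓝 (0 : ℝ) := by
      apply hg.2.preimage_mem_nhds
      rw [hg.1]
      exact hN N hN'
    obtain ⟨t, ⟨_, ⟨s, hs, rfl⟩, x, hx, hgx⟩, ht⟩ :=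
      (inter_mem (nhdsWithin_le_nhds h1) hT : _ ∈ 𝓝[>] (0 : ℝ)) |> Filter.nonempty_of_mem
    refine ⟨(t, s), hTN ⟨ht, hs⟩, ?_⟩
    have : h (t, s) = x := by
      simp only [h]
      rw [← show f s * x = g t from hgx, inv_mul_cancel_left]
    simpa [this] using hx
  let u := Ultrafilter.of l
  have hu : (u : Filter _) ≤ l := Ultrafilter.of_le l
  have ht : Tendsto Prod.fst (u : Filter (ℝ × E')) (𝓝[>] 0) :=
    tendsto_fst.mono_left (hu.trans inf_le_left)
  have hs : Tendsto Prod.snd (u : Filter (ℝ × E')) (𝓝 0) :=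
    tendsto_snd.mono_left (hu.trans inf_le_left)
  obtain ⟨ht0, htpos⟩ := tendsto_nhdsWithin_iff.1 ht
  have hmem : ∀ᶠ p in (u : Filter (ℝ × E')), h p ∈ H := hu (mem_inf_of_right (mem_principal_self _))
  have hh : Tendsto h u (𝓝 1) := by
    have h1 := hf.2.tendsto.comp hs
    have h2 := hg.2.tendsto.comp ht0
    rw [hf.1] at h1
    rw [hg.1] at h2
    simpa using h1.inv.mul h2
  let y : ℝ × E' → E := fun p ↦ extChartAt 𝓘(ℝ, E) (1 : G) (h p) - e
  have hy : Tendsto y u (𝓝 0) := by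
    have := ((continuousAt_extChartAt (I := 𝓘(ℝ, E)) (1 : G)).tendsto.comp hh).sub_const e
    rwa [← he, sub_self] at this
  -- This common scale bounds all three quantities, and the limits `τ`, `σ`, `η` of the rescaled
  -- quantities have norms summing to `1`, so they cannot all vanish.
  let δ : ℝ × E' → ℝ := fun p ↦ p.1 + ‖p.2‖ + ‖y p‖
  have hδpos : ∀ᶠ p in (u : Filter (ℝ × E')), 0 < δ p := by
    filter_upwards [htpos] with p (hp : 0 < p.1)
    positivity
  have hδ : Tendsto δ u (𝓝[>] 0) := by
    refine tendsto_nhdsWithin_iff.2 ⟨?_, hδpos⟩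
    simpa using (ht0.add hs.norm).add hy.norm
  have hbd : ∀ᶠ p in (u : Filter (ℝ × E')), ‖p.1‖ ≤ δ p ∧ ‖p.2‖ ≤ δ p ∧ ‖y p‖ ≤ δ p := by
    filter_upwards [htpos] with p (hp : 0 < p.1)
    have h1 := norm_nonneg p.2
    have h2 := norm_nonneg (y p)
    rw [Real.norm_of_nonneg hp.le]
    refine ⟨?_, ?_, ?_⟩ <;> simp only [δ] <;> linarith
  obtain ⟨τ, hτ⟩ := u.exists_tendsto_inv_smul hδpos (hbd.mono fun _ h ↦ h.1)
  obtain ⟨σ, hσ⟩ := u.exists_tendsto_inv_smul hδpos (hbd.mono fun _ h ↦ h.2.1)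
  obtain ⟨η, hη⟩ := u.exists_tendsto_inv_smul hδpos (hbd.mono fun _ h ↦ h.2.2)
  have hsum : ‖τ‖ + ‖σ‖ + ‖η‖ = 1 := by
    refine tendsto_nhds_unique ((hτ.norm.add hσ.norm).add hη.norm) ?_
    refine tendsto_const_nhds.congr' ?_
    filter_upwards [htpos, hδpos] with p (hp : 0 < p.1) hp'
    rw [norm_smul, norm_smul, norm_smul, norm_inv, Real.norm_of_nonneg hp'.le,
      Real.norm_of_nonneg hp.le, ← mul_add, ← mul_add, inv_mul_cancel₀ hp'.ne']
  have dg : HasDirection u δ (fun p ↦ g p.1) _ := hg.hasDirection ht0 (by simpa using hτ)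
  have df : HasDirection u δ (fun p ↦ f p.2) (f' σ) := hf.hasDirection hs (by simpa using hσ)
  have dh : HasDirection u δ h η := ⟨hh, hη⟩
  have heq : f' σ + η = τ • X := by
    have := (df.mul dh).unique (dg.congr (Eventually.of_forall fun p ↦ by simp [h]))
    simpa using this
  have hηH : η ∈ (closedSubgroupLieAlgebra E H : Submodule ℝ E) :=
    mem_closedSubgroupLieAlgebra_of_hasDirection hH hδ hmem dh
  -- If `τ = 0` then `f' σ = -η ∈ 𝔥`, so transversality gives `σ = 0` and then `η = 0`, against
  -- `hsum`.
  by_cases hτ0 : τ = 0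
  · exfalso
    rw [hτ0, zero_smul] at heq
    have hσ0 : σ = 0 := hf' σ (by rw [eq_neg_of_add_eq_zero_left heq]; exact neg_mem hηH)
    rw [hσ0, map_zero, zero_add] at heq
    simp [hτ0, hσ0, heq] at hsum
  · have hX : X = f' (τ⁻¹ • σ) + τ⁻¹ • η := by
      rw [map_smul, ← smul_add, heq, smul_smul, inv_mul_cancel₀ hτ0, one_smul]
    rw [hX]
    exact Submodule.add_mem_sup ⟨_, rfl⟩ (Submodule.smul_mem _ _ hηH)

end Homomorphisms

/-! ### Open orbits and the infinitesimal criterion. -/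

section Orbits

lemma isOpen_range_mul_of_mem_nhds_one {L G : Type*} [Group L] [Group G] [TopologicalSpace G]
    [IsTopologicalGroup G] {H : Subgroup G} (ι : L →* G)
    (h1 : range ι * (H : Set G) ∈ 𝓝 1) : IsOpen (range ι * (H : Set G)) := by
  rw [isOpen_iff_mem_nhds]
  rintro _ ⟨_, ⟨l, rfl⟩, h, hh, rfl⟩
  have : Tendsto (fun x : G ↦ (ι l)⁻¹ * x * h⁻¹) (𝓝 (ι l * h)) (𝓝 1) := by
    have : Continuous (fun x : G ↦ (ι l)⁻¹ * x * h⁻¹) := by fun_prop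
    simpa using this.tendsto (ι l * h)
  filter_upwards [this h1] with x hx
  obtain ⟨_, ⟨m, rfl⟩, k, hk, hx⟩ := hx
  refine ⟨_, ⟨l * m, rfl⟩, k * h, H.mul_mem hk hh, ?_⟩
  have hx' : ι m * k = (ι l)⁻¹ * x * h⁻¹ := hx
  simp only [map_mul]
  rw [mul_assoc, ← mul_assoc (ι m), hx']
  group

lemma isOpen_orbit_mk_one_iff {G : Type*} [Group G] [TopologicalSpace G] [IsTopologicalGroup G]
    (H R : Subgroup G) : IsOpen (MulAction.orbit R (QuotientGroup.mk 1 : G ⧸ H)) ↔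
      IsOpen ((R : Set G) * (H : Set G)) := by
  rw [← (QuotientGroup.isQuotientMap_mk (N := H)).isOpen_preimage]
  congr! 1
  ext g
  simp only [mem_preimage, MulAction.mem_orbit_iff, Set.mem_mul, SetLike.mem_coe]
  constructor
  · rintro ⟨r, hr⟩
    have hr' : (QuotientGroup.mk ((r : G) * 1) : G ⧸ H) = QuotientGroup.mk g := hr
    rw [mul_one, QuotientGroup.eq] at hr'
    exact ⟨r, r.2, _, hr', by simp⟩
  · rintro ⟨r, hr, h, hh, rfl⟩
    refine ⟨⟨r, hr⟩, ?_⟩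
    change (QuotientGroup.mk (r * 1) : G ⧸ H) = QuotientGroup.mk (r * h)
    rw [mul_one, QuotientGroup.eq]
    simpa using hh

lemma Submodule.surjective_projectionOnto_domRestrict_iff {K V : Type*} [Ring K] [AddCommGroup V]
    [Module K V] {p q : Submodule K V} (hpq : IsCompl p q) (r : Submodule K V) :
    Function.Surjective ((p.projectionOnto q hpq).domRestrict r) ↔ r ⊔ q = ⊤ := by
  constructor
  · refine fun h ↦ eq_top_iff.2 fun x _ ↦ ?_
    obtain ⟨y, hy⟩ := h (p.projectionOnto q hpq x)
    have hxy : x - y ∈ q := by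
      rw [← Submodule.projectionOnto_apply_eq_zero_iff hpq, map_sub, ← hy]
      exact sub_self _
    rw [← add_sub_cancel (y : V) x]
    exact Submodule.add_mem_sup y.2 hxy
  · intro h x
    obtain ⟨y, hy, z, hz, hyz⟩ := Submodule.mem_sup.1 (h ▸ Submodule.mem_top : (x : V) ∈ r ⊔ q)
    refine ⟨⟨y, hy⟩, ?_⟩
    have h1 : p.projectionOnto q hpq (y + z) = x := by
      rw [hyz, Submodule.projectionOnto_apply_left]
    rwa [map_add, Submodule.projectionOnto_apply_of_mem_right hpq hz, add_zero] at h1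

variable {E : Type*} [NormedAddCommGroup E] [NormedSpace ℝ E] [FiniteDimensional ℝ E]
  {G : Type*} [TopologicalSpace G] [T2Space G] [ChartedSpace E G] [Group G]
  [LieGroup 𝓘(ℝ, E) ∞ G]
  {E' : Type*} [NormedAddCommGroup E'] [NormedSpace ℝ E'] [FiniteDimensional ℝ E']
  {L : Type*} [TopologicalSpace L] [T2Space L] [SecondCountableTopology L] [ChartedSpace E' L]
  [Group L] [LieGroup 𝓘(ℝ, E') ∞ L]

lemma isOpen_range_mul_iff {H : Subgroup G} (hH : IsClosed (H : Set G)) (ι : L →* G)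
    (hι : ContMDiff 𝓘(ℝ, E') 𝓘(ℝ, E) 1 ι) :
    IsOpen (range ι * (H : Set G)) ↔
      (mfderiv 𝓘(ℝ, E') 𝓘(ℝ, E) ι 1 : E' →L[ℝ] E).range ⊔
        (closedSubgroupLieAlgebra E H : Submodule ℝ E) = ⊤ := by
  have : LieGroup 𝓘(ℝ, E) 1 G := .of_le (n := ∞) (by simp)
  have : LieGroup 𝓘(ℝ, E') 1 L := .of_le (n := ∞) (by simp)
  have : IsManifold 𝓘(ℝ, E) 1 G := LieGroup.toContMDiffMul.toIsManifold
  have : IsManifold 𝓘(ℝ, E') 1 L := LieGroup.toContMDiffMul.toIsManifold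
  have : IsTopologicalGroup G := topologicalGroup_of_lieGroup 𝓘(ℝ, E) 1
  have : IsTopologicalGroup L := topologicalGroup_of_lieGroup 𝓘(ℝ, E') 1
  have := FiniteDimensional.complete ℝ E
  have := FiniteDimensional.complete ℝ E'
  have := FiniteDimensional.proper ℝ E
  have := FiniteDimensional.proper ℝ E'
  have : LocallyCompactSpace G := ChartedSpace.locallyCompactSpace E G
  have : LocallyCompactSpace L := ChartedSpace.locallyCompactSpace E' L
  set D : E' →L[ℝ] E := mfderiv 𝓘(ℝ, E') 𝓘(ℝ, E) ι 1 with hD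
  have hstrict := ι.hasStrictDerivAtOne_comp_extChartAt_symm hι
  constructor
  · intro hopen
    let 𝔥 : Submodule ℝ E := closedSubgroupLieAlgebra E H
    -- The slice `S` is complementary to the directions that `D` sends into `𝔥`, so `D` is injective
    -- modulo `𝔥` on it.
    obtain ⟨S, hS⟩ := Submodule.exists_isCompl (𝔥.comap (D : E' →ₗ[ℝ] E))
    have hg : HasStrictFDerivAt (fun w : S ↦ extChartAt 𝓘(ℝ, E') (1 : L) 1 + w) S.subtypeL 0 :=
      S.subtypeL.hasStrictFDerivAt.const_add _
    have hf := HasStrictDerivAtOne.comp (x₀ := (0 : S))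
      (g := fun w : S ↦ extChartAt 𝓘(ℝ, E') (1 : L) 1 + w)
      (by rw [Submodule.coe_zero, add_zero]; exact hasStrictDerivAtOne_extChartAt_symm (G := L)) hg
    have hF := HasStrictDerivAtOne.comp (x₀ := (0 : S))
      (g := fun w : S ↦ extChartAt 𝓘(ℝ, E') (1 : L) 1 + w)
      (by rw [Submodule.coe_zero, add_zero]; exact hstrict) hg
    have hlie : 𝔥.comap (D : E' →ₗ[ℝ] E) ≤
        (closedSubgroupLieAlgebra E' (H.comap ι) : Submodule ℝ E') :=
      fun v hv ↦ mem_closedSubgroupLieAlgebra_comap hH ι hι hv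
    have hsup := range_sup_closedSubgroupLieAlgebra_eq_top hH hF (fun v hv ↦ ?_) fun N hN ↦ ?_
    · refine eq_top_iff.2 (hsup ▸ sup_le_sup_right ?_ _)
      rintro _ ⟨v, rfl⟩
      exact ⟨(v : E'), rfl⟩
    · exact Subtype.ext (Submodule.disjoint_def.1 hS.disjoint v hv v.2)
    -- The slice times `H.comap ι` fills a neighbourhood of `1` in `L`; applying `ι` and Baire, the
    -- factor from `H.comap ι` is absorbed into `H`.
    · have hV := image_mul_subgroup_mem_nhds_one (H.comap ι) hf (eq_top_iff.2 ?_) hN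
      · refine mem_of_superset
          (image_mul_mem_nhds_one_of_isOpen_range_mul hH ι hι.continuous hopen hV) ?_
        rintro _ ⟨_, ⟨_, ⟨_, ⟨w, hw, rfl⟩, h, hh, rfl⟩, rfl⟩, h', hh', rfl⟩
        refine ⟨_, ⟨w, hw, rfl⟩, ι h * h', H.mul_mem hh hh', ?_⟩
        simp [mul_assoc]
      · rw [← hS.sup_eq_top, sup_comm]
        refine sup_le_sup ?_ hlie
        intro v hv
        exact ⟨⟨v, hv⟩, rfl⟩
  · intro htop
    refine isOpen_range_mul_of_mem_nhds_one ι ?_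
    refine mem_of_superset (image_mul_subgroup_mem_nhds_one H hstrict htop univ_mem) ?_
    refine mul_subset_mul_right ?_
    rintro _ ⟨x, _, rfl⟩
    exact ⟨_, rfl⟩

end Orbits

end OpenOrbits

theorem mainTheorem9
    {E : Type*} [NormedAddCommGroup E] [NormedSpace ℝ E] [FiniteDimensional ℝ E]
    {G : Type*} [TopologicalSpace G] [T2Space G] [ChartedSpace E G] [Group G]
    [LieGroup 𝓘(ℝ, E) ∞ G]
    (H : Subgroup G) (hH : IsClosed (H : Set G))
    (𝔮 : Submodule ℝ (GroupLieAlgebra 𝓘(ℝ, E) G))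
    (h𝔮 : IsReductiveDecomposition (closedSubgroupLieAlgebra E H) 𝔮)
    (R : Subgroup G) (𝔯 : Submodule ℝ (GroupLieAlgebra 𝓘(ℝ, E) G))
    (hR : IsLieSubgroupWithLieAlgebra R 𝔯) :
    IsOpen (MulAction.orbit R (QuotientGroup.mk 1 : G ⧸ H)) ↔
      Function.Surjective
        ((Submodule.projectionOnto 𝔮 (closedSubgroupLieAlgebra E H) h𝔮.isCompl).domRestrict
          𝔯) := by
  have : IsTopologicalGroup G := topologicalGroup_of_lieGroup 𝓘(ℝ, E) ∞
  obtain ⟨d, L, _, _, _, ι, _, _, hinj, himm, rfl, h𝔯⟩ := hR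
  have hι : ContMDiff 𝓘(ℝ, EuclideanSpace ℝ (Fin d)) 𝓘(ℝ, E) 1 ι :=
    himm.contMDiff.of_le (by simp)
  -- `L` is Hausdorff because it injects continuously into `G`.
  have : T2Space L := .of_injective_continuous hinj hι.continuous
  have hrange : 𝔯 = (mfderiv 𝓘(ℝ, EuclideanSpace ℝ (Fin d)) 𝓘(ℝ, E) ι 1 :
      EuclideanSpace ℝ (Fin d) →L[ℝ] E).range := by
    ext X
    exact h𝔯 X
  rw [isOpen_orbit_mk_one_iff, Submodule.surjective_projectionOnto_domRestrict_iff,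
    MonoidHom.coe_range, isOpen_range_mul_iff hH ι hι, hrange]
  rfl
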